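/- Let $T$ be a bounded linear operator on a complex Hilbert space $\mathcal H$ and let $\lambda\in\mathbb C$. Let $\mathcal O_T=\operatorname{span}\{1,T,T^*\}$, let $C^*(T)\subseteq B(\mathcal H)$ be the unital C$^*$-algebra generated by $T$, let $\sigma(T)$ be the spectrum of $T$, and let $W(T)$ be the closure of $\{\langle T\xi,\xi\rangle : \xi\in\mathcal H,\ \|\xi\|=1\}$, with topological boundary $\partial W(T)$ in $\mathbb C$. A unital representation ($*$-homomorphism) $\rho:C^*(T)\to B(\mathcal K)$ on a Hilbert space $\mathcal K\neq 0$ is called a boundary representation for $\mathcal O_T$ if it is irreducible and $\rho$ is the only unital completely positive map $C^*(T)\to B(\mathcal K)$ that agrees with $\rho$ on $\mathcal O_T$. For a representation $\rho$ on $\mathcal K$ we write $\lambda=\rho(T)$ if $\rho(T)=\lambda 1_{\mathcal K}$; for irreducible $\rho$ this forces $\dim\mathcal K=1$. Proposition. (1) If $\lambda=\rho(T)$ for some boundary representation $\rho$ for $\mathcal O_T$, then $\lambda\in\sigma(T)\cap\partial W(T)$ and $\lambda$ is an extreme point of $W(T)$. (2) Suppose that $\lambda\in\sigma(T)\cap\partial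 W(T)$. If $\lambda$ is an extreme point of $W(T)$ and $T$ is hyponormal (that is, $T^*T-TT^*\ge 0$), then there is a one-dimensional boundary representation $\rho:C^*(T)\to B(\mathbb C)$ for $\mathcal O_T$ such that $\lambda=\rho(T)$. -/

import Mathlib

open scoped CStarAlgebra

/-- A closed unital star-subalgebra of a C⋆-algebra, with the order inherited from the
C⋆-algebra, is a star-ordered ring: its positive elements are exactly those of the form `s⋆ s`. -/
theorem starOrderedRing_of_isClosed {A : Type*} [CStarAlgebra A] [PartialOrder A]
    [StarOrderedRing A] (S : StarSubalgebra ℂ A) [hS : IsClosed (S : Set A)] :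
    StarOrderedRing S := by
  let _ : CStarAlgebra S := StarSubalgebra.cstarAlgebra S
  refine StarOrderedRing.of_nonneg_iff' (fun {x y} hxy z => ?_) (fun x => ⟨fun hx => ?_, ?_⟩)
  · exact add_le_add_right (α := A) hxy (z : A)
  · have hx' : (0 : A) ≤ (x : A) := hx
    have hsa : IsSelfAdjoint x := Subtype.ext (IsSelfAdjoint.of_nonneg hx').star_eq
    have hres : QuasispectrumRestricts x ContinuousMap.realToNNReal := by
      refine SpectrumRestricts.nnreal_iff.mpr fun r hr => ?_
      rw [← spectrum.preimage_algebraMap ℂ, Set.mem_preimage, StarSubalgebra.spectrum_eq S,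
        ← Set.mem_preimage, spectrum.preimage_algebraMap] at hr
      exact spectrum_nonneg_of_nonneg hx' hr
    obtain ⟨s, hs₁, -, hs₂⟩ := CFC.exists_sqrt_of_isSelfAdjoint_of_quasispectrumRestricts hsa hres
    exact ⟨s, by rw [hs₁.star_eq, hs₂]⟩
  · rintro ⟨s, rfl⟩
    exact star_mul_self_nonneg (s : A)

/-- The C⋆-algebra `C⋆(T)` generated by `T` (with the unit of `B(H)`), ordered as a subset of
`B(H)`, is a star-ordered ring. -/
instance elementalStarOrderedRing {H : Type*} [NormedAddCommGroup H] [InnerProductSpace ℂ H]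
    [CompleteSpace H] (T : H →L[ℂ] H) : StarOrderedRing (StarAlgebra.elemental ℂ T) :=
  starOrderedRing_of_isClosed _ (hS := StarAlgebra.elemental.isClosed ℂ T)

/-- The operator system `span {1, t, t⋆}` generated by an element `t` of a unital C⋆-algebra `A`. -/
noncomputable def operatorSystem {A : Type*} [CStarAlgebra A] (t : A) : Submodule ℂ A :=
  Submodule.span ℂ {1, t, star t}

/-- `T` as an element of `C⋆(T)`. -/
def cstarGenerator {H : Type*} [NormedAddCommGroup H] [InnerProductSpace ℂ H] [CompleteSpace H]
    (T : H →L[ℂ] H) : StarAlgebra.elemental ℂ T :=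
  ⟨T, StarAlgebra.elemental.self_mem ℂ T⟩

/-- A representation `ρ : A → B(K)` is irreducible if `K ≠ 0` and the only closed subspaces of `K`
invariant under `ρ(A)` are `0` and `K`. -/
structure IsIrreducibleRep {A K : Type*} [CStarAlgebra A] [NormedAddCommGroup K]
    [InnerProductSpace ℂ K] [CompleteSpace K] (ρ : A →⋆ₐ[ℂ] (K →L[ℂ] K)) : Prop where
  nontrivial : Nontrivial K
  eq_bot_or_eq_top : ∀ M : Submodule ℂ K, IsClosed (M : Set K) →
    (∀ a : A, ∀ v ∈ M, ρ a v ∈ M) → M = ⊥ ∨ M = ⊤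

/-- A unital representation `ρ : A → B(K)` is a boundary representation for the subspace `S` of `A`
if it is irreducible and `ρ` itself is the only unital completely positive map `A → B(K)` that
agrees with `ρ` on `S`. (Used for an operator system `S` that generates the C⋆-algebra `A`.) -/
structure IsBoundaryRep {A K : Type*} [CStarAlgebra A] [PartialOrder A] [StarOrderedRing A]
    [NormedAddCommGroup K] [InnerProductSpace ℂ K] [CompleteSpace K]
    (S : Submodule ℂ A) (ρ : A →⋆ₐ[ℂ] (K →L[ℂ] K)) : Prop where
  irreducible : IsIrreducibleRep ρ
  unique_extension : ∀ ψ : A →CP (K →L[ℂ] K), ψ 1 = 1 → (∀ x ∈ S, ψ x = ρ x) → ∀ x, ψ x = ρ x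

/-- The numerical range `W(T)`: the closure of the set of the numbers `⟨Tξ, ξ⟩`, `‖ξ‖ = 1`
(`inner ℂ` is conjugate-linear in its first argument). -/
def numericalRange {H : Type*} [NormedAddCommGroup H] [InnerProductSpace ℂ H]
    (T : H →L[ℂ] H) : Set ℂ :=
  closure {z : ℂ | ∃ ξ : H, ‖ξ‖ = 1 ∧ inner ℂ ξ (T ξ) = z}

/-- `T` is hyponormal if `T⋆ T - T T⋆` is a positive operator. -/
def IsHyponormalOperator {H : Type*} [NormedAddCommGroup H] [InnerProductSpace ℂ H]
    [CompleteSpace H] (T : H →L[ℂ] H) : Prop :=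
  (star T * T - T * star T).IsPositive

/-!
The points of `W(T)` are exactly the values at `T` of the states of `C⋆(T)`. A point of `W(T)` is a
limit of vector states along an ultrafilter (`exists_state_of_mem_numericalRange`); conversely a
state is a vector state of its GNS representation, and a value outside the closed convex set `W(T)`
(the Toeplitz–Hausdorff theorem, `convex_numericalRange`) would be separated from it by a line,
against the positivity of an element of `span {1, T, T⋆}` (`inner_rep_mem_numericalRange`).

Suppose that a boundary representation `ρ` has `ρ(T) = lam`. Then `T - lam` is in the kernel of `ρ`,
so `lam` is in the spectrum, and a vector state of `ρ` shows that `lam` is in `W(T)`. If `lam` is a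
convex combination of the values at `T` of two states, the corresponding combination `f` of these
states gives the unital completely positive map `x ↦ f x • 1`, which agrees with `ρ` at `T`. Hence
it is `ρ`, and `f` vanishes at `(T - lam)⋆ (T - lam)`. So do the two states, and the Cauchy–Schwarz
inequality shows that both take the value `lam` at `T`
(`IsBoundaryRep.apply_eq_of_convexCombination`). Thus `lam` is extreme, and therefore it is not
interior to `W(T)`.

Conversely, let `T` be hyponormal and `lam` an extreme point of `W(T)`. It suffices that every
state `f` with `f(T) = lam` is a character: two characters that agree at `T` are equal, so there is
exactly one such state, and a completely positive extension to `B(ℂ)` is a state. In the GNS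
representation of `f`, hyponormality and extremality force the cyclic vector to be an eigenvector of
the images of `T` and `T⋆` (`eigenvector_of_hyponormal_of_extreme`), and then it is an eigenvector
of the whole algebra, so that `f` is multiplicative. That `lam` lies in the spectrum is a
consequence of the extremality here.
-/

open scoped InnerProductSpace ComplexOrder
open Complex Filter Topology

/-! ### The numerical range -/

section NumericalRange

variable {H : Type*} [NormedAddCommGroup H] [InnerProductSpace ℂ H]

theorem inner_mem_numericalRange (T : H →L[ℂ] H) {ξ : H} (hξ : ‖ξ‖ = 1) :
    ⟪ξ, T ξ⟫_ℂ ∈ numericalRange T :=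
  subset_closure ⟨ξ, hξ, rfl⟩

theorem inner_normalize (T : H →L[ℂ] H) (η : H) :
    ⟪((‖η‖ : ℂ)⁻¹) • η, T (((‖η‖ : ℂ)⁻¹) • η)⟫_ℂ = ((‖η‖ ^ 2)⁻¹ : ℝ) * ⟪η, T η⟫_ℂ := by
  simp only [map_smul, inner_smul_left, inner_smul_right, map_inv₀, conj_ofReal]
  push_cast
  ring

theorem norm_normalize {η : H} (hη : η ≠ 0) : ‖((‖η‖ : ℂ)⁻¹) • η‖ = 1 := by
  rw [norm_smul, norm_inv, norm_real, norm_norm, inv_mul_cancel₀ (norm_ne_zero_iff.2 hη)]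

/-- A normalized instance of the Toeplitz–Hausdorff theorem. After `x` is multiplied by a phase
making `⟪x, S y⟫ + ⟪y, S x⟫` real, the form `⟪z, S z⟫ / ‖z‖²` is real along the segment from `x`
to `y`, and the intermediate value theorem applies. -/
theorem exists_inner_eq_of_inner_zero_one (S : H →L[ℂ] H) {x y : H} (hx : ‖x‖ = 1) (hy : ‖y‖ = 1)
    (hx0 : ⟪x, S x⟫_ℂ = 0) (hy1 : ⟪y, S y⟫_ℂ = 1) {t : ℝ} (ht : t ∈ Set.Icc (0 : ℝ) 1) :
    ∃ ξ : H, ‖ξ‖ = 1 ∧ ⟪ξ, S ξ⟫_ℂ = t := by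
  obtain ⟨u, hu, hu'⟩ : ∃ u : ℂ, ‖u‖ = 1 ∧
      (u * (⟪y, S x⟫_ℂ - (starRingEnd ℂ) ⟪x, S y⟫_ℂ)).im = 0 := by
    set w := ⟪y, S x⟫_ℂ - (starRingEnd ℂ) ⟪x, S y⟫_ℂ
    by_cases hw : w = 0
    · exact ⟨1, by simp, by simp [hw]⟩
    · refine ⟨(starRingEnd ℂ) w / ‖w‖, ?_, ?_⟩
      · simp [hw]
      · rw [div_mul_eq_mul_div, mul_comm, mul_conj, ← ofReal_div, ofReal_im]
  obtain ⟨r, hr⟩ : ∃ r : ℝ, ⟪u • x, S y⟫_ℂ + ⟪y, S (u • x)⟫_ℂ = r := by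
    refine ⟨_, (Complex.ext rfl ?_)⟩
    rw [ofReal_im, ← hu', map_smul, inner_smul_left, inner_smul_right, mul_sub, sub_im, add_im]
    simp only [mul_im, conj_re, conj_im]
    ring
  have hx0' : ⟪u • x, S (u • x)⟫_ℂ = 0 := by
    rw [map_smul, inner_smul_left, inner_smul_right, hx0, mul_zero, mul_zero]
  have hux : ‖u • x‖ = 1 := by rw [norm_smul, hu, hx, one_mul]
  generalize u • x = x' at *
  let z : ℝ → H := fun s => ((1 - s : ℝ) : ℂ) • x' + (s : ℂ) • y
  have hz : ∀ s, ⟪z s, S (z s)⟫_ℂ = ((s ^ 2 + s * (1 - s) * r : ℝ) : ℂ) := by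
    intro s
    simp only [z, map_add, map_smul, inner_add_left, inner_add_right, inner_smul_left,
      inner_smul_right, hx0', hy1, conj_ofReal]
    push_cast
    rw [← hr]
    ring
  -- Unit vectors with `z s = 0` are opposite, and then the form takes the same value at both.
  have hz0 : ∀ s ∈ Set.Icc (0 : ℝ) 1, z s ≠ 0 := by
    intro s hs h0
    have h1 : ((1 - s : ℝ) : ℂ) • x' = -((s : ℂ) • y) := eq_neg_of_add_eq_zero_left h0
    have h2 := congrArg norm h1
    rw [norm_neg, norm_smul, norm_smul, hux, hy, norm_real, norm_real, Real.norm_eq_abs,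
      Real.norm_eq_abs, abs_of_nonneg hs.1, abs_of_nonneg (by linarith [hs.2])] at h2
    have h3 : s = 1 / 2 := by linarith
    have h4 : x' = -y := by
      have h5 : ((1 / 2 : ℝ) : ℂ) • x' = ((1 / 2 : ℝ) : ℂ) • (-y) := by
        rw [smul_neg, ← h3, ← h1, h3]
        norm_num
      exact smul_right_injective H (by norm_num) h5
    rw [h4] at hx0'
    simp [hy1] at hx0'
  have hcont : ContinuousOn (fun s : ℝ => (‖z s‖ ^ 2)⁻¹ * (s ^ 2 + s * (1 - s) * r))
      (Set.Icc 0 1) := by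
    have hzc : Continuous z := by fun_prop
    refine ContinuousOn.mul (ContinuousOn.inv₀ (by fun_prop) fun s hs => ?_) (by fun_prop)
    exact pow_ne_zero 2 (norm_ne_zero_iff.2 (hz0 s hs))
  obtain ⟨s, hs, hst⟩ := intermediate_value_Icc zero_le_one hcont
    (show t ∈ _ by simpa [z, hy] using ht)
  refine ⟨((‖z s‖ : ℂ)⁻¹) • z s, norm_normalize (hz0 s hs), ?_⟩
  rw [inner_normalize, hz, ← ofReal_mul]
  exact congrArg _ hst

/-- The **Toeplitz–Hausdorff theorem**, for the closure of the numerical range. -/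
theorem convex_numericalRange (T : H →L[ℂ] H) : Convex ℝ (numericalRange T) := by
  refine Convex.closure ?_
  rw [convex_iff_forall_pos]
  rintro _ ⟨x, hx, rfl⟩ _ ⟨y, hy, rfl⟩ p q hp hq hpq
  set a := ⟪x, T x⟫_ℂ with ha
  set b := ⟪y, T y⟫_ℂ with hb
  by_cases hab : a = b
  · refine ⟨x, hx, ?_⟩
    rw [← hab, ← add_smul, hpq, one_smul]
  have hba : b - a ≠ 0 := sub_ne_zero.2 (Ne.symm hab)
  let S : H →L[ℂ] H := (b - a)⁻¹ • (T - a • (1 : H →L[ℂ] H))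
  have hS : ∀ ξ : H, ‖ξ‖ = 1 → ⟪ξ, S ξ⟫_ℂ = (b - a)⁻¹ * (⟪ξ, T ξ⟫_ℂ - a) := by
    intro ξ hξ
    change ⟪ξ, (b - a)⁻¹ • (T ξ - a • ξ)⟫_ℂ = _
    rw [inner_smul_right, inner_sub_right, inner_smul_right, inner_self_eq_norm_sq_to_K, hξ]
    simp
  obtain ⟨ξ, hξ, h⟩ := exists_inner_eq_of_inner_zero_one S hx hy (by rw [hS x hx]; simp [ha])
    (by rw [hS y hy, ← hb, inv_mul_cancel₀ hba]) (t := q) ⟨hq.le, by linarith⟩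
  refine ⟨ξ, hξ, ?_⟩
  rw [hS ξ hξ, inv_mul_eq_iff_eq_mul₀ hba] at h
  rw [sub_eq_iff_eq_add.1 h, real_smul, real_smul, show p = 1 - q by linarith]
  push_cast
  ring

end NumericalRange

/-! ### Convex subsets of the plane -/

/-- A supporting line at a point of a plane convex set that is not interior to it. If the interior
is empty, the set is contained in a line, which supports it at each of its points. -/
theorem Complex.exists_support_of_notMem_interior {W : Set ℂ} (hW : Convex ℝ W) {lam : ℂ}
    (hlam : lam ∈ W) (hint : lam ∉ interior W) :
    ∃ u : ℂ, u ≠ 0 ∧ ∀ w ∈ W, 0 ≤ (u * (w - lam)).re := by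
  by_cases hne : (interior W).Nonempty
  · obtain ⟨f, hf0, hf⟩ :=
      RCLike.geometric_hahn_banach_of_nonempty_interior_point (𝕜 := ℂ) hW hint hne
    have hf1 : ∀ z, f z = z * f 1 := fun z => by
      conv_lhs => rw [← mul_one z, ← smul_eq_mul, map_smul, smul_eq_mul]
    refine ⟨-f 1, ?_, fun w hw => ?_⟩
    · refine neg_ne_zero.2 fun h => hf0 ?_
      ext
      simpa using h
    · have := hf w hw
      rw [hf1 w, hf1 lam] at this
      have h2 : -f 1 * (w - lam) = lam * f 1 - w * f 1 := by ring
      rw [h2, sub_re]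
      exact sub_nonneg.2 this
  · have hspan : vectorSpan ℝ W < ⊤ := by
      rw [lt_top_iff_ne_top, Ne,
        ← AffineSubspace.affineSpan_eq_top_iff_vectorSpan_eq_top_of_nonempty ℝ ℂ ℂ ⟨lam, hlam⟩,
        ← hW.interior_nonempty_iff_affineSpan_eq_top]
      exact hne
    obtain ⟨f, hf0, hf⟩ := Submodule.exists_le_ker_of_lt_top _ hspan
    have hfz : ∀ z : ℂ, f z = (((f 1 : ℝ) - (f I : ℝ) * I) * z).re := fun z => by
      have hz : z = z.re • (1 : ℂ) + z.im • I := by simp [re_add_im]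
      conv_lhs => rw [hz, map_add, map_smul, map_smul, smul_eq_mul, smul_eq_mul]
      simp
      ring
    refine ⟨(f 1 : ℝ) - (f I : ℝ) * I, fun h => hf0 ?_, fun w hw => ?_⟩
    · ext1 z
      rw [hfz, h]
      simp
    · rw [← hfz]
      exact (LinearMap.mem_ker.1 (hf (vsub_mem_vectorSpan ℝ hw hlam))).ge

/-- Extreme points are not interior. -/
theorem Complex.notMem_interior_of_mem_extremePoints {W : Set ℂ} {lam : ℂ}
    (h : lam ∈ Set.extremePoints ℝ W) : lam ∉ interior W := by
  intro hint
  obtain ⟨ε, hε, hball⟩ := Metric.isOpen_iff.1 isOpen_interior lam hint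
  have hmem : ∀ s : ℝ, |s| = ε / 2 → lam + s ∈ W := fun s hs => interior_subset <| hball <| by
    simp [hs, hε]
  have hseg : lam ∈ openSegment ℝ (lam + (ε / 2 : ℝ)) (lam + (-(ε / 2) : ℝ)) := by
    refine ⟨1 / 2, 1 / 2, by norm_num, by norm_num, by norm_num, ?_⟩
    simp only [real_smul]
    push_cast
    ring
  have := h.2 (hmem _ (abs_of_pos (by positivity)))
    (hmem _ (by rw [abs_neg, abs_of_pos (by positivity)])) hseg
  simp at this
  exact hε.ne' this

/-! ### Positive functionals and states -/

section Functionals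

variable {A : Type*} [CStarAlgebra A] [PartialOrder A] [StarOrderedRing A]

namespace PositiveLinearMap

/-- Every state is a vector state of a representation: for the GNS representation and the class of
the unit, `⟪v, π x v⟫ = f x`. -/
theorem exists_rep_vector.{u} {A : Type u} [CStarAlgebra A] [PartialOrder A] [StarOrderedRing A]
    (f : A →ₚ[ℂ] ℂ) (hf : f 1 = 1) :
    ∃ (K : Type u) (_ : NormedAddCommGroup K) (_ : InnerProductSpace ℂ K) (_ : CompleteSpace K)
      (π : A →⋆ₐ[ℂ] (K →L[ℂ] K)) (v : K), ‖v‖ = 1 ∧ ∀ x, ⟪v, π x v⟫_ℂ = f x := by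
  have hin : ∀ x, ⟪((f.toPreGNS 1 : f.PreGNS) : f.GNS),
      f.gnsStarAlgHom x ((f.toPreGNS 1 : f.PreGNS) : f.GNS)⟫_ℂ = f x := by
    intro x
    have h : f.gnsStarAlgHom x ((f.toPreGNS 1 : f.PreGNS) : f.GNS)
        = ((f.toPreGNS (x * 1) : f.PreGNS) : f.GNS) :=
      f.gnsNonUnitalStarAlgHom_apply_coe
    rw [h, UniformSpace.Completion.inner_coe, preGNS_inner_def]
    simp
  refine ⟨f.GNS, inferInstance, inferInstance, inferInstance, f.gnsStarAlgHom,
    ((f.toPreGNS 1 : f.PreGNS) : f.GNS), ?_, hin⟩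
  rw [UniformSpace.Completion.norm_coe, preGNS_norm_def]
  simp [hf]

/-- A multiplicative state is a character. -/
theorem exists_character_of_map_mul (f : A →ₚ[ℂ] ℂ) (hf : f 1 = 1)
    (hmul : ∀ x y, f (x * y) = f x * f y) : ∃ χ : A →⋆ₐ[ℂ] ℂ, ∀ x, f x = χ x :=
  ⟨{ AlgHom.ofLinearMap f.toLinearMap hf hmul with map_star' := fun x => map_star f x },
    fun _ => rfl⟩

/-- By the Cauchy–Schwarz inequality, `f (x⋆ x) = 0` implies `f x = 0`. -/
theorem apply_eq_zero_of_star_mul_self (f : A →ₚ[ℂ] ℂ) {x : A} (hx : f (star x * x) = 0) :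
    f x = 0 := by
  have h1 : ‖f.toPreGNS x‖ = 0 := by
    rw [preGNS_norm_def, ofPreGNS_toPreGNS, hx]
    simp
  have h2 := norm_inner_le_norm (𝕜 := ℂ) (f.toPreGNS 1) (f.toPreGNS x)
  rw [h1, mul_zero, preGNS_inner_def, ofPreGNS_toPreGNS, ofPreGNS_toPreGNS, star_one,
    one_mul] at h2
  exact norm_le_zero_iff.1 h2

open scoped MatrixOrder in
/-- A positive functional is completely positive: writing a positive matrix over `A` as `N⋆ N`,
its image is the sum over the rows of `N` of their Gram matrices for the GNS inner product. -/
theorem map_cstarMatrix_nonneg (f : A →ₚ[ℂ] ℂ) {k : ℕ} {M : CStarMatrix (Fin k) (Fin k) A}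
    (hM : 0 ≤ M) : 0 ≤ M.map f := by
  have hadd : ∀ M N : CStarMatrix (Fin k) (Fin k) A, (M + N).map f = M.map f + N.map f :=
    fun M N => CStarMatrix.ext fun i j => map_add f (M i j) (N i j)
  rw [StarOrderedRing.nonneg_iff] at hM
  induction hM using AddSubmonoid.closure_induction with
  | zero => exact le_of_eq (CStarMatrix.ext fun i j => (map_zero f).symm)
  | add M N _ _ hM hN => rw [hadd]; exact add_nonneg hM hN
  | mem M hM =>
    obtain ⟨N, rfl⟩ := hM
    have hps : Matrix.PosSemidef (∑ l, Matrix.gram ℂ fun j => f.toPreGNS (N l j)) :=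
      Matrix.posSemidef_sum _ fun l _ => Matrix.posSemidef_gram ℂ _
    obtain ⟨B, hB⟩ := CStarAlgebra.nonneg_iff_eq_star_mul_self.1 hps.nonneg
    have h : (star N * N).map f = star (CStarMatrix.ofMatrix B) * CStarMatrix.ofMatrix B := by
      change _ = star B * B
      rw [← hB]
      refine Matrix.ext fun i j => ?_
      rw [Matrix.sum_apply]
      change f ((star N * N) i j) = _
      rw [CStarMatrix.mul_apply, map_sum]
      rfl
    exact h ▸ star_mul_self_nonneg (CStarMatrix.ofMatrix B)

/-- The completely positive map `x ↦ f x • 1` associated with a positive functional. -/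
noncomputable def scalarCP (f : A →ₚ[ℂ] ℂ) (K : Type*) [NormedAddCommGroup K]
    [InnerProductSpace ℂ K] [CompleteSpace K] : A →CP (K →L[ℂ] K) where
  toLinearMap := (StarAlgHom.ofId ℂ (K →L[ℂ] K)).toAlgHom.toLinearMap ∘ₗ f.toLinearMap
  map_cstarMatrix_nonneg' k _ hM :=
    CompletelyPositiveMapClass.map_cstarMatrix_nonneg' (StarAlgHom.ofId ℂ (K →L[ℂ] K)) k _
      (f.map_cstarMatrix_nonneg hM)

theorem scalarCP_apply (f : A →ₚ[ℂ] ℂ) (K : Type*) [NormedAddCommGroup K]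
    [InnerProductSpace ℂ K] [CompleteSpace K] (x : A) :
    f.scalarCP K x = f x • (1 : K →L[ℂ] K) :=
  Algebra.algebraMap_eq_smul_one (f x)

end PositiveLinearMap

variable {K : Type*} [NormedAddCommGroup K] [InnerProductSpace ℂ K]

theorem ContinuousLinearMap.inner_apply_nonneg {D : K →L[ℂ] K} (hD : 0 ≤ D) (v : K) :
    0 ≤ ⟪v, D v⟫_ℂ :=
  ((ContinuousLinearMap.nonneg_iff_isPositive D).1 hD).inner_nonneg_right v

/-- The positive functional `x ↦ ⟪v, φ x v⟫` defined by a positive operator-valued map `φ` and a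
vector `v`. -/
noncomputable def vectorFunctional {F : Type*} [FunLike F A (K →L[ℂ] K)]
    [LinearMapClass F ℂ A (K →L[ℂ] K)] [OrderHomClass F A (K →L[ℂ] K)] (φ : F) (v : K) :
    A →ₚ[ℂ] ℂ :=
  PositiveLinearMap.mk₀
    { toFun := fun x => ⟪v, φ x v⟫_ℂ
      map_add' := fun x y => by
        rw [map_add, add_apply, inner_add_right]
      map_smul' := fun c x => by
        rw [map_smul, smul_apply, inner_smul_right, RingHom.id_apply,
          smul_eq_mul] }
    fun _ hx => ContinuousLinearMap.inner_apply_nonneg (map_nonneg φ hx) v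

theorem vectorFunctional_apply {F : Type*} [FunLike F A (K →L[ℂ] K)]
    [LinearMapClass F ℂ A (K →L[ℂ] K)] [OrderHomClass F A (K →L[ℂ] K)] (φ : F) (v : K) (x : A) :
    vectorFunctional φ v x = ⟪v, φ x v⟫_ℂ :=
  rfl

/-- A positive operator kills every vector at which its quadratic form vanishes. -/
theorem ContinuousLinearMap.apply_eq_zero_of_inner_eq_zero [CompleteSpace K] {D : K →L[ℂ] K}
    (hD : 0 ≤ D) {v : K} (hv : ⟪v, D v⟫_ℂ = 0) : D v = 0 := by
  obtain ⟨C, rfl⟩ := CStarAlgebra.nonneg_iff_eq_star_mul_self.1 hD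
  rw [mul_apply_eq_comp, ContinuousLinearMap.star_eq_adjoint,
    ContinuousLinearMap.adjoint_inner_right, inner_self_eq_zero] at hv
  rw [mul_apply_eq_comp, hv, map_zero]

end Functionals

/-! ### Extreme points of the numerical range of a hyponormal operator -/

section Hyponormal

variable {K : Type*} [NormedAddCommGroup K] [InnerProductSpace ℂ K] [CompleteSpace K]

open ContinuousLinearMap in
/-- If `T` is hyponormal and `⟪ξ, T ξ⟫` is an extreme point of a convex set `W` containing the
numerical range, then `ξ` is an eigenvector of both `T` and `T⋆`.

Let `S = u (T - lam)`, where `u` is the normal of a supporting line, so that `S + S⋆ ≥ 0`.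
Hyponormality makes `ker (S + S⋆)` invariant under `S`; it contains `ξ`, and the quadratic form of
`S` is purely imaginary on it. If `S ξ ≠ 0`, that form takes values of both signs at the vectors
`ξ + i t S ξ` with `t` real and small, so that `lam` is interior to a segment of `W`. -/
theorem eigenvector_of_hyponormal_of_extreme {T : K →L[ℂ] K} (hT : 0 ≤ star T * T - T * star T)
    {W : Set ℂ} (hW : Convex ℝ W) (hTW : ∀ v : K, ‖v‖ = 1 → ⟪v, T v⟫_ℂ ∈ W) {lam : ℂ}
    (hext : lam ∈ Set.extremePoints ℝ W) {ξ : K} (hξ : ‖ξ‖ = 1) (hlam : ⟪ξ, T ξ⟫_ℂ = lam) :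
    T ξ = lam • ξ ∧ star T ξ = (starRingEnd ℂ) lam • ξ := by
  obtain ⟨u, hu, hsup⟩ := Complex.exists_support_of_notMem_interior hW hext.1
    (Complex.notMem_interior_of_mem_extremePoints hext)
  obtain ⟨S, hS⟩ : ∃ S : K →L[ℂ] K, S = u • (T - lam • (1 : K →L[ℂ] K)) := ⟨_, rfl⟩
  have hSin : ∀ v, ⟪v, S v⟫_ℂ = u * (⟪v, T v⟫_ℂ - lam * (‖v‖ ^ 2 : ℝ)) := by
    intro v
    rw [hS, smul_apply, sub_apply, smul_apply, one_apply_eq_self, inner_smul_right, inner_sub_right,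
      inner_smul_right, inner_self_eq_norm_sq_to_K]
    simp
  -- Normalizing a vector turns a value of the form of `S` into a point of `u (W - lam)`.
  have hSW : ∀ v, v ≠ 0 → ∃ w ∈ W, u * (w - lam) = ((‖v‖ ^ 2)⁻¹ : ℝ) * ⟪v, S v⟫_ℂ := by
    intro v hv
    refine ⟨_, hTW _ (norm_normalize hv), ?_⟩
    rw [hSin, inner_normalize]
    have : (‖v‖ : ℂ) ≠ 0 := by exact_mod_cast norm_ne_zero_iff.2 hv
    push_cast
    field_simp
  have hSs : ∀ v w, ⟪v, star S w⟫_ℂ = ⟪S v, w⟫_ℂ := fun v w => adjoint_inner_right S v w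
  have hre : ∀ v, ⟪v, (S + star S) v⟫_ℂ = (2 * (⟪v, S v⟫_ℂ).re : ℝ) := by
    intro v
    rw [add_apply, inner_add_right, hSs, ← inner_conj_symm (S v) v, add_conj]
  -- The supporting line says that the real part of `S` is positive.
  have hpos : 0 ≤ S + star S := by
    rw [nonneg_iff_isPositive, isPositive_iff']
    refine ⟨IsSelfAdjoint.add_star_self S, fun v => ?_⟩
    rw [← inner_conj_symm, hre, conj_ofReal]
    by_cases hv : v = 0
    · simp [hv]
    obtain ⟨w, hw, h⟩ := hSW v hv
    have h1 := hsup w hw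
    rw [h, re_ofReal_mul] at h1
    have h2 : 0 < (‖v‖ ^ 2)⁻¹ := by positivity
    exact_mod_cast mul_nonneg zero_le_two (nonneg_of_mul_nonneg_right h1 h2)
  have hhyp : 0 ≤ star S * S - S * star S := by
    have : star S * S - S * star S
        = ((star u * u : ℂ)) • (star T * T - T * star T) := by
      rw [hS]
      simp only [star_smul, star_sub, star_one, mul_sub, sub_mul, mul_one,
        one_mul, smul_mul_assoc, mul_smul_comm, smul_sub, smul_smul]
      rw [mul_comm u (star u)]
      module
    rw [this]
    exact smul_nonneg (star_mul_self_nonneg u) hT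
  -- On `ker (S + S⋆)` the form of the self-commutator vanishes, so the self-commutator does too.
  have hinv : ∀ v, star S v = -S v → star S (S v) = -S (S v) := by
    intro v hv
    have h1 : (star S * S - S * star S) v = 0 := by
      refine apply_eq_zero_of_inner_eq_zero hhyp ?_
      rw [sub_apply, mul_apply_eq_comp, mul_apply_eq_comp, inner_sub_right, hSs, hv, map_neg,
        inner_neg_right, ← adjoint_inner_left S (S v) v, ← star_eq_adjoint, hv, inner_neg_left,
        sub_neg_eq_add, add_neg_cancel]
    rw [sub_apply, mul_apply_eq_comp, mul_apply_eq_comp, hv, map_neg, sub_eq_zero] at h1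
    exact h1
  have hξ0 : ⟪ξ, S ξ⟫_ℂ = 0 := by
    rw [hSin, hlam, hξ]
    simp
  have hξN : star S ξ = -S ξ := by
    have := apply_eq_zero_of_inner_eq_zero hpos (v := ξ) (by rw [hre, hξ0]; simp)
    rw [add_apply, add_comm] at this
    exact eq_neg_of_add_eq_zero_left this
  have hζN := hinv ξ hξN
  have hSξ : S ξ = 0 := by
    by_contra hne
    have hc : 0 < ‖S ξ‖ ^ 2 := by positivity
    obtain ⟨k, hk⟩ : ∃ k : ℝ, ⟪S ξ, S (S ξ)⟫_ℂ = k * I := by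
      have h1 : (starRingEnd ℂ) ⟪S ξ, S (S ξ)⟫_ℂ = -⟪S ξ, S (S ξ)⟫_ℂ := by
        rw [inner_conj_symm, ← hSs, hζN, inner_neg_right]
      refine ⟨_, Complex.ext ?_ (by simp; rfl)⟩
      have := congrArg re h1
      simp only [conj_re, neg_re] at this
      simp
      linarith
    set c := ‖S ξ‖ ^ 2
    have h2 : ⟪ξ, S (S ξ)⟫_ℂ = -(c : ℂ) := by
      rw [← neg_neg (S (S ξ)), ← hζN, inner_neg_right, hSs, inner_self_eq_norm_sq_to_K]
      simp [c]
    have h3 : ⟪S ξ, S ξ⟫_ℂ = c := by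
      rw [inner_self_eq_norm_sq_to_K]
      simp [c]
    have hform : ∀ t : ℝ, ⟪ξ + (t * I) • S ξ, S (ξ + (t * I) • S ξ)⟫_ℂ
        = ((t * (t * k - 2 * c) : ℝ) : ℂ) * I := by
      intro t
      rw [map_add, map_smul, inner_add_left, inner_add_right, inner_add_right, inner_smul_left,
        inner_smul_left, inner_smul_right, inner_smul_right, hξ0, h2, h3, hk]
      simp only [map_mul, conj_ofReal, conj_I]
      push_cast
      linear_combination (-(t : ℂ) ^ 2 * k * I) * I_sq
    have hpt : ∀ t : ℝ, t * (t * k - 2 * c) ≠ 0 →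
        ∃ s : ℝ, 0 < s ∧ lam + (s * (t * (t * k - 2 * c)) : ℝ) * (u⁻¹ * I) ∈ W := by
      intro t ht
      have hne : ξ + (t * I) • S ξ ≠ 0 := by
        intro h0
        have := hform t
        rw [h0, inner_zero_left, eq_comm, mul_eq_zero, ofReal_eq_zero] at this
        exact this.elim ht I_ne_zero
      obtain ⟨w, hw, h⟩ := hSW _ hne
      rw [hform] at h
      refine ⟨(‖ξ + (t * I) • S ξ‖ ^ 2)⁻¹, by positivity, ?_⟩
      convert hw
      have h4 : w = lam + u⁻¹ * (u * (w - lam)) := by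
        rw [inv_mul_cancel_left₀ hu]
        ring
      rw [h4, h]
      push_cast
      ring
    -- For this `t₀`, the linear term `2 c t` dominates the quadratic one at `t = ± t₀`.
    obtain ⟨t₀, ht₀, htk⟩ : ∃ t₀ : ℝ, 0 < t₀ ∧ |t₀ * k| < 2 * c := by
      refine ⟨c / (|k| + 1), by positivity, ?_⟩
      rw [abs_mul, abs_of_pos (by positivity), div_mul_eq_mul_div, div_lt_iff₀ (by positivity)]
      nlinarith [abs_nonneg k]
    obtain ⟨hl, hr⟩ := abs_lt.1 htk
    have hneg : t₀ * (t₀ * k - 2 * c) < 0 := mul_neg_of_pos_of_neg ht₀ (by linarith)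
    have hposv : 0 < -t₀ * (-t₀ * k - 2 * c) := by nlinarith
    obtain ⟨s₁, hs₁, hw₁⟩ := hpt t₀ hneg.ne
    obtain ⟨s₂, hs₂, hw₂⟩ := hpt (-t₀) hposv.ne'
    set a := s₁ * (t₀ * (t₀ * k - 2 * c))
    set b := s₂ * (-t₀ * (-t₀ * k - 2 * c))
    have ha : a < 0 := mul_neg_of_pos_of_neg hs₁ hneg
    have hb : 0 < b := mul_pos hs₂ hposv
    have hab : b - a ≠ 0 := by linarith
    have hseg : lam ∈ openSegment ℝ (lam + (a : ℂ) * (u⁻¹ * I)) (lam + (b : ℂ) * (u⁻¹ * I)) := by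
      refine ⟨b / (b - a), -a / (b - a), by apply div_pos <;> linarith,
        by apply div_pos <;> linarith, by field_simp; ring, ?_⟩
      have hab' : (b : ℂ) - a ≠ 0 := by exact_mod_cast hab
      simp only [real_smul]
      push_cast
      field_simp
      ring
    have := hext.2 hw₁ hw₂ hseg
    simp [ha.ne, hu] at this
  constructor
  · rw [hS, smul_apply, smul_eq_zero_iff_right hu, sub_apply, smul_apply, one_apply_eq_self] at hSξ
    exact sub_eq_zero.1 hSξ
  · rw [hSξ, neg_zero, hS, star_smul, star_sub, star_smul, star_one, smul_apply,
      smul_eq_zero_iff_right (by simpa using hu), sub_apply, smul_apply, one_apply_eq_self] at hξN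
    exact sub_eq_zero.1 hξN

end Hyponormal

/-! ### States on the C⋆-algebra generated by an operator -/

section Generated

variable {H : Type*} [NormedAddCommGroup H] [InnerProductSpace ℂ H] [CompleteSpace H]
  {K : Type*} [NormedAddCommGroup K] [InnerProductSpace ℂ K] [CompleteSpace K]

open StarAlgebra (elemental)

/-- The quadratic form of `2 c - (u S + (u S)⋆)`, whose positivity says that the numerical range of
`S` lies in the half-plane `Re (u z) ≤ c`. -/
theorem inner_halfPlane_apply (S : K →L[ℂ] K) (u : ℂ) (c : ℝ) (w : K) :
    ⟪w, ((2 * c : ℂ) • (1 : K →L[ℂ] K) - (u • S + star (u • S))) w⟫_ℂ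
      = (2 * (c * ‖w‖ ^ 2 - (u * ⟪w, S w⟫_ℂ).re) : ℝ) := by
  have h1 : ⟪w, star (u • S) w⟫_ℂ = (starRingEnd ℂ) (u * ⟪w, S w⟫_ℂ) := by
    rw [ContinuousLinearMap.star_eq_adjoint, ContinuousLinearMap.adjoint_inner_right,
      ← inner_conj_symm, smul_apply, inner_smul_right]
  rw [sub_apply, add_apply, smul_apply, smul_apply, one_apply_eq_self, inner_sub_right,
    inner_add_right, h1, inner_smul_right, inner_smul_right, add_conj,
    inner_self_eq_norm_sq_to_K, RCLike.ofReal_eq_complex_ofReal]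
  push_cast
  ring

/-- Representations of `C⋆(T)` do not enlarge the numerical range: each half-plane containing
`W(T)` amounts to the positivity of an element of `span {1, T, T⋆}`, which representations
preserve, and `W(T)` is the intersection of these half-planes. -/
theorem inner_rep_mem_numericalRange (T : H →L[ℂ] H) (π : elemental ℂ T →⋆ₐ[ℂ] (K →L[ℂ] K))
    {v : K} (hv : ‖v‖ = 1) : ⟪v, π (cstarGenerator T) v⟫_ℂ ∈ numericalRange T := by
  by_contra hnot
  obtain ⟨u, c, hc, hcv⟩ : ∃ (u : ℂ) (c : ℝ), (∀ w ∈ numericalRange T, (u * w).re < c) ∧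
      c < (u * ⟪v, π (cstarGenerator T) v⟫_ℂ).re := by
    obtain ⟨f, c, hc, hcv⟩ := RCLike.geometric_hahn_banach_closed_point (𝕜 := ℂ)
      (convex_numericalRange T) isClosed_closure hnot
    have hf1 : ∀ z, f z = f 1 * z := fun z => by
      conv_lhs => rw [← mul_one z, ← smul_eq_mul, map_smul, smul_eq_mul, mul_comm]
    exact ⟨f 1, c, fun w hw => hf1 w ▸ hc w hw, hf1 _ ▸ hcv⟩
  have hP : (0 : elemental ℂ T) ≤
      (2 * c : ℂ) • 1 - (u • cstarGenerator T + star (u • cstarGenerator T)) := by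
    change (0 : H →L[ℂ] H) ≤ (2 * c : ℂ) • (1 : H →L[ℂ] H) - (u • T + star (u • T))
    rw [ContinuousLinearMap.nonneg_iff_isPositive, ContinuousLinearMap.isPositive_iff']
    refine ⟨?_, fun w => ?_⟩
    · refine IsSelfAdjoint.sub ?_ (IsSelfAdjoint.add_star_self _)
      rw [isSelfAdjoint_iff, star_smul, star_one]
      simp
    · rw [← inner_conj_symm, inner_halfPlane_apply, conj_ofReal]
      by_cases hw : w = 0
      · simp [hw]
      have h1 := hc _ (inner_mem_numericalRange T (norm_normalize hw))
      have h2 : 0 < ‖w‖ ^ 2 := by positivity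
      rw [inner_normalize, mul_left_comm, re_ofReal_mul, inv_mul_lt_iff₀ h2,
        mul_comm (‖w‖ ^ 2)] at h1
      exact_mod_cast mul_nonneg zero_le_two (sub_nonneg.2 h1.le)
  have h := ContinuousLinearMap.inner_apply_nonneg (map_nonneg π hP) v
  rw [map_sub, map_add, map_star, map_smul, map_smul, map_one, inner_halfPlane_apply, hv] at h
  have h' := Complex.zero_le_real.1 h
  linarith

/-- Every point of the numerical range is the value at `T` of a state: a limit of vector states
along an ultrafilter. -/
theorem exists_state_of_mem_numericalRange (T : H →L[ℂ] H) {μ : ℂ} (hμ : μ ∈ numericalRange T) :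
    ∃ f : elemental ℂ T →ₚ[ℂ] ℂ, f 1 = 1 ∧ f (cstarGenerator T) = μ := by
  obtain ⟨U, hU, hUμ⟩ := mem_closure_iff_ultrafilter.1 hμ
  have hex : ∀ z : ℂ, ∃ ξ : H, z ∈ {z : ℂ | ∃ ξ : H, ‖ξ‖ = 1 ∧ ⟪ξ, T ξ⟫_ℂ = z} →
      ‖ξ‖ = 1 ∧ ⟪ξ, T ξ⟫_ℂ = z := fun z => by
    by_cases hz : z ∈ {z : ℂ | ∃ ξ : H, ‖ξ‖ = 1 ∧ ⟪ξ, T ξ⟫_ℂ = z}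
    · obtain ⟨ξ, hξ⟩ := hz
      exact ⟨ξ, fun _ => hξ⟩
    · exact ⟨0, fun h => (hz h).elim⟩
  choose ξ hξ using hex
  have hlim : ∀ x : elemental ℂ T, ∃ l : ℂ,
      Tendsto (fun z => ⟪ξ z, (x : H →L[ℂ] H) (ξ z)⟫_ℂ) U (𝓝 l) := by
    intro x
    obtain ⟨l, -, hl⟩ := (isCompact_closedBall (0 : ℂ) ‖(x : H →L[ℂ] H)‖).ultrafilter_le_nhds
      (U.map fun z => ⟪ξ z, (x : H →L[ℂ] H) (ξ z)⟫_ℂ) (by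
        rw [le_principal_iff, Ultrafilter.mem_coe, Ultrafilter.mem_map]
        filter_upwards [hU] with z hz
        rw [Set.mem_preimage, mem_closedBall_zero_iff]
        have h1 := (hξ z hz).1
        refine (norm_inner_le_norm _ _).trans ?_
        simpa [h1] using (x : H →L[ℂ] H).le_opNorm (ξ z))
    exact ⟨l, hl⟩
  choose φ hφ using hlim
  refine ⟨PositiveLinearMap.mk₀ { toFun := φ, map_add' := ?_, map_smul' := ?_ } ?_, ?_, ?_⟩
  · intro x y
    refine tendsto_nhds_unique (hφ (x + y)) (((hφ x).add (hφ y)).congr fun z => ?_)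
    rw [← inner_add_right]
    rfl
  · intro c x
    refine tendsto_nhds_unique (hφ (c • x)) (((hφ x).const_mul c).congr fun z => ?_)
    rw [← inner_smul_right]
    rfl
  · intro x hx
    refine ge_of_tendsto (hφ x) (Eventually.of_forall fun z => ?_)
    exact ContinuousLinearMap.inner_apply_nonneg (D := (x : H →L[ℂ] H)) hx _
  · refine tendsto_nhds_unique (hφ 1) (tendsto_const_nhds.congr' ?_)
    filter_upwards [hU] with z hz
    change 1 = ⟪ξ z, ξ z⟫_ℂ
    rw [inner_self_eq_norm_sq_to_K, (hξ z hz).1]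
    simp
  · refine tendsto_nhds_unique (hφ (cstarGenerator T)) (Tendsto.congr' ?_ hUμ)
    filter_upwards [hU] with z hz
    exact (hξ z hz).2.symm

/-- A unit eigenvector of both `π(T)` and `π(T)⋆` is an eigenvector of all of `π(C⋆(T))`. -/
theorem rep_apply_eq_smul_of_eigenvector (T : H →L[ℂ] H)
    (π : elemental ℂ T →⋆ₐ[ℂ] (K →L[ℂ] K)) {v : K} (hv : ‖v‖ = 1) {a b : ℂ}
    (ha : π (cstarGenerator T) v = a • v) (hb : star (π (cstarGenerator T)) v = b • v)
    (x : elemental ℂ T) : π x v = ⟪v, π x v⟫_ℂ • v := by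
  have hvv : ⟪v, v⟫_ℂ = 1 := by
    rw [inner_self_eq_norm_sq_to_K, hv]
    simp
  have key : ∀ (y : elemental ℂ T) (c : ℂ), π y v = c • v → π y v = ⟪v, π y v⟫_ℂ • v := by
    intro y c h
    rw [h, inner_smul_right, hvv, mul_one]
  have hπ : Continuous π := map_continuous π
  have hcl : IsClosed {y : elemental ℂ T | π y v = ⟪v, π y v⟫_ℂ • v} := by
    apply isClosed_eq <;> fun_prop
  refine StarAlgebra.elemental.induction_on ℂ x.2
    (P := fun y hy => π ⟨y, hy⟩ v = ⟪v, π ⟨y, hy⟩ v⟫_ℂ • v) ?_ ?_ ?_ ?_ ?_ ?_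
  · exact key _ a ha
  · exact key (star (cstarGenerator T)) b (by rw [map_star, hb])
  · intro r
    refine key (algebraMap ℂ _ r) r ?_
    rw [AlgHomClass.commutes, Algebra.algebraMap_eq_smul_one, smul_apply, one_apply_eq_self]
  · intro y hy z hz h1 h2
    obtain ⟨c, hc⟩ : ∃ c : ℂ, π ⟨y, hy⟩ v = c • v := ⟨_, h1⟩
    obtain ⟨d, hd⟩ : ∃ d : ℂ, π ⟨z, hz⟩ v = d • v := ⟨_, h2⟩
    refine key (⟨y, hy⟩ + ⟨z, hz⟩) (c + d) ?_
    rw [map_add, add_apply, hc, hd, ← add_smul]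
  · intro y hy z hz h1 h2
    obtain ⟨c, hc⟩ : ∃ c : ℂ, π ⟨y, hy⟩ v = c • v := ⟨_, h1⟩
    obtain ⟨d, hd⟩ : ∃ d : ℂ, π ⟨z, hz⟩ v = d • v := ⟨_, h2⟩
    refine key (⟨y, hy⟩ * ⟨z, hz⟩) (d * c) ?_
    rw [map_mul, mul_apply_eq_comp, hd, map_smul, hc, smul_smul]
  · intro s hs h y hy
    have hsub : closure s ⊆ Subtype.val '' {y : elemental ℂ T | π y v = ⟪v, π y v⟫_ℂ • v} :=
      closure_minimal (fun z hz => ⟨⟨z, hs hz⟩, h z hz, rfl⟩)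
        ((StarAlgebra.elemental.isClosedEmbedding_coe ℂ T).isClosedMap _ hcl)
    obtain ⟨z, hz, rfl⟩ := hsub hy
    exact hz

/-- Representations of `C⋆(T)` preserve hyponormality. -/
theorem IsHyponormalOperator.rep {T : H →L[ℂ] H} (hT : IsHyponormalOperator T)
    (π : elemental ℂ T →⋆ₐ[ℂ] (K →L[ℂ] K)) :
    0 ≤ star (π (cstarGenerator T)) * π (cstarGenerator T)
      - π (cstarGenerator T) * star (π (cstarGenerator T)) := by
  have h0 : (0 : H →L[ℂ] H) ≤ star T * T - T * star T :=
    (ContinuousLinearMap.nonneg_iff_isPositive _).2 hT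
  have h1 : (0 : elemental ℂ T) ≤ star (cstarGenerator T) * cstarGenerator T
      - cstarGenerator T * star (cstarGenerator T) := h0
  have h2 := map_nonneg π h1
  rwa [map_sub, map_mul, map_mul, map_star] at h2

/-- A vector state of a representation of `C⋆(T)`, for hyponormal `T`, whose value at `T` is an
extreme point of `W(T)` is multiplicative. -/
theorem inner_rep_mul_of_hyponormal {T : H →L[ℂ] H} (hT : IsHyponormalOperator T) {lam : ℂ}
    (hext : lam ∈ Set.extremePoints ℝ (numericalRange T))
    (π : elemental ℂ T →⋆ₐ[ℂ] (K →L[ℂ] K)) {v : K} (hv : ‖v‖ = 1)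
    (hlam : ⟪v, π (cstarGenerator T) v⟫_ℂ = lam) (x y : elemental ℂ T) :
    ⟪v, π (x * y) v⟫_ℂ = ⟪v, π x v⟫_ℂ * ⟪v, π y v⟫_ℂ := by
  obtain ⟨ha, hb⟩ := eigenvector_of_hyponormal_of_extreme (hT.rep π) (convex_numericalRange T)
    (fun w hw => inner_rep_mem_numericalRange T π hw) hext hv hlam
  obtain ⟨c, hc⟩ : ∃ c : ℂ, c = ⟪v, π y v⟫_ℂ := ⟨_, rfl⟩
  rw [map_mul, mul_apply_eq_comp, rep_apply_eq_smul_of_eigenvector T π hv ha hb y, ← hc, map_smul,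
    inner_smul_right, inner_smul_right, inner_self_eq_norm_sq_to_K, hv]
  simp [mul_comm]

/-- A state of `C⋆(T)`, for hyponormal `T`, whose value at `T` is an extreme point of `W(T)` is a
character, since it is a vector state of its GNS representation. -/
theorem exists_character_eq_of_hyponormal {T : H →L[ℂ] H} (hT : IsHyponormalOperator T) {lam : ℂ}
    (hext : lam ∈ Set.extremePoints ℝ (numericalRange T)) {f : elemental ℂ T →ₚ[ℂ] ℂ}
    (hf1 : f 1 = 1) (hf : f (cstarGenerator T) = lam) :
    ∃ χ : elemental ℂ T →⋆ₐ[ℂ] ℂ, ∀ x, f x = χ x := by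
  obtain ⟨K, _, _, _, π, v, hv, h⟩ := f.exists_rep_vector hf1
  refine f.exists_character_of_map_mul hf1 fun x y => ?_
  rw [← h (x * y), ← h x, ← h y]
  exact inner_rep_mul_of_hyponormal hT hext π hv ((h _).trans hf) x y

end Generated

/-! ### Boundary representations with scalar value at the generator -/

section Boundary

theorem mem_spectrum_of_rep_eq_smul_one {A K : Type*} [Ring A] [Algebra ℂ A]
    [NormedAddCommGroup K] [InnerProductSpace ℂ K] [Nontrivial K] {ρ : A →ₐ[ℂ] (K →L[ℂ] K)} {t : A}
    {lam : ℂ} (hlam : ρ t = lam • (1 : K →L[ℂ] K)) : lam ∈ spectrum ℂ t := by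
  intro h
  have h1 := h.map ρ
  rw [map_sub, hlam, AlgHomClass.commutes, Algebra.algebraMap_eq_smul_one, sub_self] at h1
  exact not_isUnit_zero h1

variable {A : Type*} [CStarAlgebra A] [PartialOrder A] [StarOrderedRing A]
  {K : Type*} [NormedAddCommGroup K] [InnerProductSpace ℂ K] [CompleteSpace K]

/-- If a boundary representation `ρ` takes the scalar value `lam` at `t` and `lam` is a convex
combination of the values of two states at `t`, then those values are `lam`. By the unique
extension property the convex combination `f` of the states satisfies `f • 1 = ρ`, so `f` vanishes
at `(t - lam)⋆ (t - lam)`; hence so do the two states. -/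
theorem IsBoundaryRep.apply_eq_of_convexCombination {t : A} {ρ : A →⋆ₐ[ℂ] (K →L[ℂ] K)}
    (hρ : IsBoundaryRep (operatorSystem t) ρ) {lam : ℂ} (hlam : ρ t = lam • (1 : K →L[ℂ] K))
    {f g : A →ₚ[ℂ] ℂ} (hf : f 1 = 1) (hg : g 1 = 1) {a b : ℝ} (ha : 0 < a) (hb : 0 ≤ b)
    (hab : a + b = 1) (h : a * f t + b * g t = lam) : f t = lam := by
  have ha' : (0 : ℂ) ≤ a := zero_le_real.2 ha.le
  have hb' : (0 : ℂ) ≤ b := zero_le_real.2 hb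
  have hab' : (a : ℂ) + b = 1 := by exact_mod_cast hab
  obtain ⟨φ, hφ⟩ : ∃ φ : A →ₚ[ℂ] ℂ, ∀ x, φ x = a * f x + b * g x :=
    ⟨PositiveLinearMap.mk₀ ((a : ℂ) • f.toLinearMap + (b : ℂ) • g.toLinearMap) fun x hx =>
      add_nonneg (mul_nonneg ha' (f.map_nonneg hx)) (mul_nonneg hb' (g.map_nonneg hx)),
      fun _ => rfl⟩
  have hφ1 : φ 1 = 1 := by rw [hφ, hf, hg, mul_one, mul_one, hab']
  have hφt : φ t = lam := by rw [hφ, h]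
  have hS : ∀ x ∈ operatorSystem t, φ.scalarCP K x = ρ x := by
    intro x hx
    rw [φ.scalarCP_apply]
    induction hx using Submodule.span_induction with
    | mem x hx =>
      obtain rfl | rfl | rfl := hx
      · rw [hφ1, one_smul, map_one]
      · rw [hφt, hlam]
      · rw [map_star, map_star, hφt, hlam, star_smul, star_one]
    | zero => rw [map_zero, map_zero, zero_smul]
    | add x y _ _ hx hy => rw [map_add, map_add, add_smul, hx, hy]
    | smul c x _ hx => rw [map_smul, map_smul, smul_assoc, hx]
  have hall := hρ.unique_extension (φ.scalarCP K)
    (by rw [φ.scalarCP_apply, hφ1, one_smul]) hS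
  have := hρ.irreducible.nontrivial
  have hzero : φ (star (t - lam • 1) * (t - lam • 1)) = 0 := by
    have h1 := hall (star (t - lam • 1) * (t - lam • 1))
    rw [φ.scalarCP_apply, map_mul ρ, map_sub ρ t, hlam, map_smul, map_one, sub_self,
      mul_zero] at h1
    exact (smul_eq_zero.1 h1).resolve_right one_ne_zero
  have hfz : f (star (t - lam • 1) * (t - lam • 1)) = 0 := by
    rw [hφ] at hzero
    have h0 := star_mul_self_nonneg (t - lam • 1)
    have h1 := (add_eq_zero_iff_of_nonneg (mul_nonneg ha' (f.map_nonneg h0))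
      (mul_nonneg hb' (g.map_nonneg h0))).1 hzero
    exact (mul_eq_zero.1 h1.1).resolve_left (by exact_mod_cast ha.ne')
  have := f.apply_eq_zero_of_star_mul_self hfz
  rw [map_sub, map_smul, hf, smul_eq_mul, mul_one] at this
  exact sub_eq_zero.1 this

/-- A character is a boundary representation if it is the only state taking its value at `t`. -/
theorem isBoundaryRep_of_unique_state {t : A} {χ : A →⋆ₐ[ℂ] ℂ}
    (huniq : ∀ f : A →ₚ[ℂ] ℂ, f 1 = 1 → f t = χ t → ∀ x, f x = χ x) :
    IsBoundaryRep (operatorSystem t) ((StarAlgHom.ofId ℂ (ℂ →L[ℂ] ℂ)).comp χ) where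
  irreducible :=
    { nontrivial := inferInstance
      eq_bot_or_eq_top := fun M _ _ => eq_bot_or_eq_top M }
  unique_extension := by
    intro ψ hψ hS x
    have hρ : ∀ x, (StarAlgHom.ofId ℂ (ℂ →L[ℂ] ℂ)).comp χ x = χ x • (1 : ℂ →L[ℂ] ℂ) :=
      fun x => Algebra.algebraMap_eq_smul_one (A := ℂ →L[ℂ] ℂ) (χ x)
    have hval : ∀ x, vectorFunctional ψ (1 : ℂ) x = ψ x 1 := by
      intro x
      rw [vectorFunctional_apply]
      simp
    have h := huniq (vectorFunctional ψ (1 : ℂ)) (by rw [hval, hψ, one_apply_eq_self]) (by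
      rw [hval, hS t (Submodule.subset_span (by simp)), hρ, smul_apply, one_apply_eq_self,
        smul_eq_mul, mul_one]) x
    rw [hval] at h
    refine ContinuousLinearMap.ext_ring ?_
    rw [h, hρ, smul_apply, one_apply_eq_self, smul_eq_mul, mul_one]

end Boundary

theorem mainTheorem7 {H : Type*} [NormedAddCommGroup H] [InnerProductSpace ℂ H]
    [CompleteSpace H] (T : H →L[ℂ] H) (lam : ℂ) :
    (∀ (K : Type*) [NormedAddCommGroup K] [InnerProductSpace ℂ K] [CompleteSpace K]
      (ρ : StarAlgebra.elemental ℂ T →⋆ₐ[ℂ] (K →L[ℂ] K)),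
      IsBoundaryRep (operatorSystem (cstarGenerator T)) ρ →
        ρ (cstarGenerator T) = lam • (1 : K →L[ℂ] K) →
        lam ∈ spectrum ℂ T ∩ frontier (numericalRange T) ∧
          lam ∈ Set.extremePoints ℝ (numericalRange T)) ∧
    (lam ∈ spectrum ℂ T ∩ frontier (numericalRange T) →
      lam ∈ Set.extremePoints ℝ (numericalRange T) → IsHyponormalOperator T →
        ∃ ρ : StarAlgebra.elemental ℂ T →⋆ₐ[ℂ] (ℂ →L[ℂ] ℂ),
          IsBoundaryRep (operatorSystem (cstarGenerator T)) ρ ∧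
            ρ (cstarGenerator T) = lam • (1 : ℂ →L[ℂ] ℂ)) := by
  constructor
  · intro K _ _ _ ρ hρ hlam
    have := hρ.irreducible.nontrivial
    have hspec : lam ∈ spectrum ℂ T := by
      have h := mem_spectrum_of_rep_eq_smul_one (ρ := ρ.toAlgHom) hlam
      exact (StarSubalgebra.mem_spectrum_iff (StarAlgebra.elemental ℂ T)
        (hS := StarAlgebra.elemental.isClosed ℂ T)).1 h
    have hmem : lam ∈ numericalRange T := by
      obtain ⟨v, hv⟩ := exists_norm_eq K zero_le_one
      have h := inner_rep_mem_numericalRange T ρ hv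
      rw [hlam, smul_apply, one_apply_eq_self, inner_smul_right, inner_self_eq_norm_sq_to_K,
        hv] at h
      simpa using h
    have hext : lam ∈ Set.extremePoints ℝ (numericalRange T) := by
      refine ⟨hmem, fun z hz w hw hzw => ?_⟩
      obtain ⟨f, hf1, hf⟩ := exists_state_of_mem_numericalRange T hz
      obtain ⟨g, hg1, hg⟩ := exists_state_of_mem_numericalRange T hw
      obtain ⟨a, b, ha, hb, hab, h⟩ := hzw
      rw [← hf, hρ.apply_eq_of_convexCombination hlam hf1 hg1 ha hb.le hab]
      rw [hf, hg, ← h, real_smul, real_smul]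
    exact ⟨⟨hspec, subset_closure hmem, Complex.notMem_interior_of_mem_extremePoints hext⟩, hext⟩
  · intro _ hext hT
    obtain ⟨f, hf1, hf⟩ := exists_state_of_mem_numericalRange T hext.1
    obtain ⟨χ, hχ⟩ := exists_character_eq_of_hyponormal hT hext hf1 hf
    have hχt : χ (cstarGenerator T) = lam := (hχ _).symm.trans hf
    refine ⟨_, isBoundaryRep_of_unique_state (χ := χ) fun g hg1 hg x => ?_, ?_⟩
    · obtain ⟨χ', hχ'⟩ := exists_character_eq_of_hyponormal hT hext hg1 (hg.trans hχt)
      have : χ' = χ := StarAlgebra.elemental.starAlgHomClass_ext ℂ (map_continuous χ')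
        (map_continuous χ) ((hχ' _).symm.trans hg)
      rw [hχ', this]
    · exact (Algebra.algebraMap_eq_smul_one (A := ℂ →L[ℂ] ℂ) (χ (cstarGenerator T))).trans
        (congrArg (· • (1 : ℂ →L[ℂ] ℂ)) hχt)
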